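/- **Setting.** Fix $m,n$ and let $U=\mathbb R^{m\times n}$ be the set of payoff matrices of a two-player game (rows: strategies of the first player, columns: strategies of the second player). A capability level is an element $c$ of $\overline{\mathbb Z}_+=\{1,2,\dots\}\cup\{\infty\}$. For $A\in U$ and $r\ge 0$, let $\mathcal S_r(A)$ be the set of all truncated singular value decompositions of $A$, i.e. of all triples $(\mathbf U,\Sigma,\mathbf V)$ with $\mathbf U\in\mathbb R^{m\times m}$, $\mathbf V\in\mathbb R^{n\times n}$ orthogonal for which there are $\sigma_1\ge\dots\ge\sigma_{\min(m,n)}\ge0$ with $A=\mathbf U\,\mathrm{diag}(\sigma_1,\dots,\sigma_{\min(m,n)})\mathbf V^{T}$ and $\Sigma=\mathrm{diag}(\sigma_1,\dots,\sigma_r,0,\dots,0)$ (rectangular $m\times n$ diagonal matrices). A *perception-compatible choice function* is a map $\mathfrak f$ from sets of such triples to $U$ such that, for all $A\in U$ and $1\le r\le\min(m,n)$: (i) $\mathfrak f(\mathcal S_r(A))=\mathbf U\Sigma\mathbf V^T$ for some $(\mathbf U,\Sigma,\mathbf V)\in\mathcal S_r(A)$; (ii) $\mathfrak f(\mathcal S_{r_1}(A))=\mathfrak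 f(\mathcal S_{r_1}(\mathfrak f(\mathcal S_{r_2}(A))))$ for $1\le r_1<r_2\le\min(m,n)$; (iii) $\mathfrak f(\mathcal S_r(-A))=-\mathfrak f(\mathcal S_r(A))$. The *limited-rank game* given by $\mathfrak f$ is the game with payoff perception function $P(A,c)=\mathfrak f(\mathcal S_{\min(c,m,n)}(A))$: a player of capability $c$ perceives the true payoff matrix $A$ as $P(A,c)$. For $v\in U$ let $\kappa(v)=\min\{c\in\overline{\mathbb Z}_+: P(v,c)=v\}$ and $P^{-1}(v,c)=\{u\in U: P(u,\max(\kappa(v),c))=v\}$. The lower and upper bounds of the true payoff are $$\mathcal P^-(v,c,x,y)=\inf_{u\in P^{-1}(v,c)}x^Tuy,\qquad \mathcal P^+(v,c,x,y)=\sup_{u\in P^{-1}(v,c)}x^Tuy .$$ Let $T(v,c_1,c_2)=\{u\in U:\kappa(u)\le c_2,\ P(v,\min(c_1,c_2))=P(u,\min(c_1,c_2))\}$. An instance of the zero-sum game with capability levels $c_1\le c_2$, in which the first player perceives the payoff matrices as $(u_1,-u_1)$, is *narrowly reversible* (for the first player) if for every $x$ in the probability simplex of $\mathbb R^m$ and every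 standard basis vector $e_k$ of $\mathbb R^n$, $$\mathcal P^-(u_1,c_1,x,e_k)=\inf_{u'\in T(u_1,c_1,c_2)}\mathcal P^+(u',c_2,x,e_k).$$ Let $\sigma_c(A)$ be the $c$-th largest singular value of $A$, with $\sigma_c(A)=0$ if $c>\min(m,n)$ (including $c=\infty$), and let $N(A)$ denote a matrix whose columns form an orthonormal basis of the null space of $A$ (no columns if the null space is trivial). **Theorem (Payoff bounds of limited-rank games).** Let $P$ be the payoff perception function of a limited-rank game. 1. Let $A\in\mathbb R^{m\times n}$ be the perceived payoff matrix of a player with capability level $c\in\overline{\mathbb Z}_+$, i.e. $A=P(T,c)$ for some true payoff matrix $T\in\mathbb R^{m\times n}$. Then for all $x\in\mathbb R^m$, $y\in\mathbb R^n$ and any choice of the orthonormal bases $N(A^T)$ and $N(A)$, $$\mathcal P^{\mp}(A,c,x,y)=x^TAy\mp\sigma_c(A)\,\|N(A^T)^Tx\|_2\,\|N(A)^Ty\|_2 .$$ 2. The limited-rank game is narrowly reversible: for every true payoff matrix $T\in\mathbb R^{m\times n}$ (of a zero-sum game) and all capability levels $c_1<c_2$ in $\overline{\mathbb Z}_+$,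 and also for $c_1=c_2\ge\min(m,n)$, the instance in which the first player perceives $u_1=P(T,c_1)$ is narrowly reversible. -/

import Mathlib

open scoped Matrix

noncomputable section

namespace LimitedPerception

/-! ### Two-player games with limited payoff perception

A payoff function is an `m × n` real matrix. A capability level is an extended positive integer,
represented by `c : ℕ∞` with `1 ≤ c`. -/

/-- The intrinsic capability of `u`: the least capability level `c` with `P u c = u`. -/
def intrinsicCapability {m n : ℕ}
    (P : Matrix (Fin m) (Fin n) ℝ → ℕ∞ → Matrix (Fin m) (Fin n) ℝ)
    (u : Matrix (Fin m) (Fin n) ℝ) : ℕ∞ :=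
  sInf {c : ℕ∞ | 1 ≤ c ∧ P u c = u}

/-- The payoff concretization set: the true payoff functions compatible with the perception `v`
of a capability-`c` player. -/
def concretization {m n : ℕ}
    (P : Matrix (Fin m) (Fin n) ℝ → ℕ∞ → Matrix (Fin m) (Fin n) ℝ)
    (v : Matrix (Fin m) (Fin n) ℝ) (c : ℕ∞) : Set (Matrix (Fin m) (Fin n) ℝ) :=
  {u | P u (max (intrinsicCapability P v) c) = v}

/-- Lower bound of the expected true payoff. The infimum is taken in the extended reals, so that
it is the honest infimum whether or not the set is bounded. -/
def minPayoff {m n : ℕ}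
    (P : Matrix (Fin m) (Fin n) ℝ → ℕ∞ → Matrix (Fin m) (Fin n) ℝ)
    (v : Matrix (Fin m) (Fin n) ℝ) (c : ℕ∞) (x : Fin m → ℝ) (y : Fin n → ℝ) : EReal :=
  ⨅ u ∈ concretization P v c, ((x ⬝ᵥ (u *ᵥ y) : ℝ) : EReal)

/-- Upper bound of the expected true payoff. -/
def maxPayoff {m n : ℕ}
    (P : Matrix (Fin m) (Fin n) ℝ → ℕ∞ → Matrix (Fin m) (Fin n) ℝ)
    (v : Matrix (Fin m) (Fin n) ℝ) (c : ℕ∞) (x : Fin m → ℝ) (y : Fin n → ℝ) : EReal :=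
  ⨆ u ∈ concretization P v c, ((x ⬝ᵥ (u *ᵥ y) : ℝ) : EReal)

/-- The narrow concretization set: if a capability-`c₁` player perceives `v`, the possible
perceptions of the same payoff function by a capability-`c₂` player. -/
def narrowConcretization {m n : ℕ}
    (P : Matrix (Fin m) (Fin n) ℝ → ℕ∞ → Matrix (Fin m) (Fin n) ℝ)
    (v : Matrix (Fin m) (Fin n) ℝ) (c₁ c₂ : ℕ∞) : Set (Matrix (Fin m) (Fin n) ℝ) :=
  {u | intrinsicCapability P u ≤ c₂ ∧ P v (min c₁ c₂) = P u (min c₁ c₂)}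

/-- Narrow reversibility, for the first player, of the zero-sum game instance in which the players
have capability levels `c₁` and `c₂`, and the first player perceives the payoff matrices as
`(u₁, -u₁)`. The pure strategies of the second player are the vectors `Pi.single k 1`. -/
def IsNarrowlyReversible {m n : ℕ}
    (P : Matrix (Fin m) (Fin n) ℝ → ℕ∞ → Matrix (Fin m) (Fin n) ℝ)
    (u₁ : Matrix (Fin m) (Fin n) ℝ) (c₁ c₂ : ℕ∞) : Prop :=
  ∀ x ∈ stdSimplex ℝ (Fin m), ∀ k : Fin n,
    minPayoff P u₁ c₁ x (Pi.single k 1) =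
      ⨅ u' ∈ narrowConcretization P u₁ c₁ c₂, maxPayoff P u' c₂ x (Pi.single k 1)

/-! ### Truncated singular value decompositions and limited-rank games -/

/-- The `m × n` matrix with diagonal entries `σ 0, σ 1, …` and zeros elsewhere. -/
def rectDiag (m n : ℕ) (σ : ℕ → ℝ) : Matrix (Fin m) (Fin n) ℝ :=
  Matrix.of fun i j => if (i : ℕ) = (j : ℕ) then σ i else 0

/-- Triples `(U, Σ, V)`, meant as the decomposition `U * Σ * Vᵀ`. -/
abbrev Triple (m n : ℕ) : Type :=
  Matrix (Fin m) (Fin m) ℝ × Matrix (Fin m) (Fin n) ℝ × Matrix (Fin n) (Fin n) ℝ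

/-- The matrix `U * Σ * Vᵀ` represented by a triple. -/
def Triple.toMatrix {m n : ℕ} (t : Triple m n) : Matrix (Fin m) (Fin n) ℝ :=
  t.1 * t.2.1 * t.2.2ᵀ

/-- The set of all truncated SVDs of `A` that keep the `r` largest singular values: `U` and `V` are
orthogonal, `A = U * diag (σ 0, σ 1, …) * Vᵀ` with `σ 0 ≥ σ 1 ≥ … ≥ 0`, and `Σ` is obtained from
`diag (σ 0, σ 1, …)` by zeroing all diagonal entries but the first `r`. Only the first `min m n`
values of `σ` matter. -/
def truncatedSVDs {m n : ℕ} (A : Matrix (Fin m) (Fin n) ℝ) (r : ℕ) : Set (Triple m n) :=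
  {t | t.1ᵀ * t.1 = 1 ∧ t.2.2ᵀ * t.2.2 = 1 ∧
    ∃ σ : ℕ → ℝ, Antitone σ ∧ (∀ i, 0 ≤ σ i) ∧
      A = t.1 * rectDiag m n σ * t.2.2ᵀ ∧
      t.2.1 = rectDiag m n (fun i => if i < r then σ i else 0)}

/-- Perception-compatible choice functions: they select from each set of truncated SVDs the matrix
represented by one of its members, consistently under repeated truncation and under negation. -/
structure IsPerceptionCompatible {m n : ℕ}
    (f : Set (Triple m n) → Matrix (Fin m) (Fin n) ℝ) : Prop where
  mem : ∀ (A : Matrix (Fin m) (Fin n) ℝ) (r : ℕ), 1 ≤ r → r ≤ min m n →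
    f (truncatedSVDs A r) ∈ Triple.toMatrix '' truncatedSVDs A r
  trunc : ∀ (A : Matrix (Fin m) (Fin n) ℝ) (r₁ r₂ : ℕ), 1 ≤ r₁ → r₁ < r₂ → r₂ ≤ min m n →
    f (truncatedSVDs A r₁) = f (truncatedSVDs (f (truncatedSVDs A r₂)) r₁)
  neg : ∀ (A : Matrix (Fin m) (Fin n) ℝ) (r : ℕ), 1 ≤ r → r ≤ min m n →
    f (truncatedSVDs (-A) r) = -f (truncatedSVDs A r)

/-- The payoff perception function of the limited-rank game given by the choice function `f`. -/
def lowRankPerception {m n : ℕ} (f : Set (Triple m n) → Matrix (Fin m) (Fin n) ℝ)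
    (A : Matrix (Fin m) (Fin n) ℝ) (c : ℕ∞) : Matrix (Fin m) (Fin n) ℝ :=
  f (truncatedSVDs A (min c ((min m n : ℕ) : ℕ∞)).toNat)

/-- The `c`-th largest singular value of `A` (counted from `1`); it is `0` for `c > min m n`,
including `c = ⊤`. Mathlib counts singular values from `0`. -/
def sigma {m n : ℕ} (A : Matrix (Fin m) (Fin n) ℝ) (c : ℕ∞) : ℝ :=
  if c = ⊤ then 0 else (Matrix.toEuclideanLin A).singularValues (c.toNat - 1)

/-- The columns of `N` form an orthonormal basis of the null space of `A` (`N` has no columns if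
the null space is trivial). -/
def IsNullBasis {m n k : ℕ} (A : Matrix (Fin m) (Fin n) ℝ) (N : Matrix (Fin n) (Fin k) ℝ) : Prop :=
  Nᵀ * N = 1 ∧ ∀ z : Fin n → ℝ, A *ᵥ z = 0 ↔ z ∈ Submodule.span ℝ (Set.range N.col)

/-- The Euclidean norm of a vector. -/
def norm2 {k : ℕ} (v : Fin k → ℝ) : ℝ :=
  ‖WithLp.toLp 2 v‖

end LimitedPerception

end

namespace LimitedPerception

variable {m n : ℕ}

/-! A perceived matrix `A` has rank at most `c`, and `κ(A) ≤ c` is equivalent to this, so the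
concretization set consists of the `u` with `P(u, c) = A`. For such `u` the residual `E = u - A`
carries the discarded singular triples. Hence `AᵀE = 0`, `AEᵀ = 0`, and the operator norm of `E` is
at most the last kept singular value, `σ_c(A)` (`residual`). So `xᵀEy` only sees the null space
components of `x` and `y`, and Cauchy–Schwarz gives the bounds (`abs_residual_le`).

They are sharp: for unit vectors `a`, `b` along those components and `|s| < σ_c(A)`, every rank-`c`
truncated SVD of `A + s·abᵀ` gives back `A`, whatever the choice function does
(`IsSVD.trunc_add_smul_vecMulVec`). At `|s| = σ_c(A)` ties appear, so the bounds are only approached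
as `s` tends to `σ_c(A)`.

For reversibility with `c₁ < c₂`, the perturbed matrix `A - s·abᵀ` has rank at most `c₁ + 1 ≤ c₂`,
so the stronger player may perceive it exactly. Its residuals are orthogonal to `a` and to the
columns of `A`, hence to `x`, so no uncertainty remains and the value is close to the lower bound.
-/

lemma rectDiag_transpose (m n : ℕ) (σ : ℕ → ℝ) : (rectDiag m n σ)ᵀ = rectDiag n m σ := by
  ext i j
  simp only [rectDiag, Matrix.transpose_apply, Matrix.of_apply]
  by_cases h : (i : ℕ) = j
  · simp [h]
  · simp [h, Ne.symm h]

lemma rectDiag_congr {σ τ : ℕ → ℝ} (h : ∀ i < min m n, σ i = τ i) :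
    rectDiag m n σ = rectDiag m n τ := by
  ext i j
  simp only [rectDiag, Matrix.of_apply]
  split_ifs with hij
  · exact h _ (by omega)
  · rfl

lemma rectDiag_transpose_mul (m n : ℕ) (σ τ : ℕ → ℝ) :
    (rectDiag m n σ)ᵀ * rectDiag m n τ =
      Matrix.diagonal fun j : Fin n => if (j : ℕ) < m then σ j * τ j else 0 := by
  ext i j
  simp only [Matrix.mul_apply, Matrix.transpose_apply, rectDiag, Matrix.of_apply,
    Matrix.diagonal_apply, ite_mul, mul_ite, zero_mul, mul_zero]
  by_cases hi : (i : ℕ) < m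
  · rw [Finset.sum_eq_single (⟨i, hi⟩ : Fin m)]
    · by_cases hij : i = j
      · subst hij; simp [hi]
      · have : (i : ℕ) ≠ j := fun h => hij (Fin.ext h)
        simp [hij, this]
    · intro k _ hk
      have : (k : ℕ) ≠ i := fun h => hk (Fin.ext h)
      simp [this]
    · simp
  · rw [Finset.sum_eq_zero]
    · simp [hi]
    · intro k _
      have : (k : ℕ) ≠ i := by omega
      simp [this]

lemma rectDiag_mul_diagonal (m n r : ℕ) (σ : ℕ → ℝ) :
    rectDiag m n σ * Matrix.diagonal (fun j : Fin n => if (j : ℕ) < r then (1 : ℝ) else 0) =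
      rectDiag m n (fun i => if i < r then σ i else 0) := by
  ext i j
  simp only [Matrix.mul_diagonal, rectDiag, Matrix.of_apply]
  by_cases h : (i : ℕ) = j <;> simp [h]

/-! ### Singular value decompositions and rank -/

/-- `A = U * diag (σ 0, σ 1, …) * Vᵀ` is a singular value decomposition of `A`. -/
structure IsSVD (A : Matrix (Fin m) (Fin n) ℝ) (U : Matrix (Fin m) (Fin m) ℝ)
    (V : Matrix (Fin n) (Fin n) ℝ) (σ : ℕ → ℝ) : Prop where
  left : Uᵀ * U = 1
  right : Vᵀ * V = 1
  anti : Antitone σ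
  nonneg : ∀ i, 0 ≤ σ i
  eq : A = U * rectDiag m n σ * Vᵀ

namespace IsSVD

variable {A : Matrix (Fin m) (Fin n) ℝ} {U : Matrix (Fin m) (Fin m) ℝ}
  {V : Matrix (Fin n) (Fin n) ℝ} {σ : ℕ → ℝ}

lemma right' (h : IsSVD A U V σ) : V * Vᵀ = 1 := mul_eq_one_comm.mp h.right

lemma transpose (h : IsSVD A U V σ) : IsSVD Aᵀ V U σ where
  left := h.right
  right := h.left
  anti := h.anti
  nonneg := h.nonneg
  eq := by
    rw [h.eq]
    simp only [Matrix.transpose_mul, Matrix.transpose_transpose, rectDiag_transpose,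
      Matrix.mul_assoc]

lemma trunc (h : IsSVD A U V σ) (r : ℕ) :
    IsSVD (U * rectDiag m n (fun i => if i < r then σ i else 0) * Vᵀ) U V
      (fun i => if i < r then σ i else 0) where
  left := h.left
  right := h.right
  anti := by
    intro i j hij
    have := h.anti hij
    have := h.nonneg i
    dsimp only
    split_ifs <;> first | assumption | omega | exact le_rfl
  nonneg := by
    intro i
    have := h.nonneg i
    split_ifs <;> first | assumption | exact le_rfl
  eq := rfl

lemma gram (h : IsSVD A U V σ) :
    Aᵀ * A = V * Matrix.diagonal (fun j : Fin n => if (j : ℕ) < m then σ j ^ 2 else 0) * Vᵀ := by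
  simp only [pow_two]
  rw [← rectDiag_transpose_mul]
  conv_lhs => rw [h.eq]
  simp only [Matrix.transpose_mul, Matrix.transpose_transpose, Matrix.mul_assoc]
  rw [← Matrix.mul_assoc Uᵀ, h.left, Matrix.one_mul]

lemma antitone_sq (h : IsSVD A U V σ) :
    Antitone (fun j : Fin n => if (j : ℕ) < m then σ j ^ 2 else 0) := by
  intro i j hij
  have h1 : (i : ℕ) ≤ j := hij
  have h2 : σ j ^ 2 ≤ σ i ^ 2 := pow_le_pow_left₀ (h.nonneg _) (h.anti h1) 2
  have h3 := sq_nonneg (σ i)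
  dsimp only
  split_ifs <;> first | assumption | omega | exact le_rfl

/-- The Gram matrix is similar to a diagonal matrix, so the eigenvalues of the adjoint composite and
the squares of `σ` are the same multiset of roots of one characteristic polynomial. Both lists are
decreasing, so they agree entry by entry. -/
theorem singularValues_eq (h : IsSVD A U V σ) {i : ℕ} (hi : i < min m n) :
    (Matrix.toEuclideanLin A).singularValues i = σ i := by
  set T := Matrix.toEuclideanLin A with hT
  have hn : Module.finrank ℝ (EuclideanSpace ℝ (Fin n)) = n := by simp
  have hcomp : LinearMap.adjoint T ∘ₗ T =
      Matrix.toLin (PiLp.basisFun 2 ℝ (Fin n)) (PiLp.basisFun 2 ℝ (Fin n)) (Aᵀ * A) := by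
    rw [hT, ← Matrix.toEuclideanLin_conjTranspose_eq_adjoint,
      Matrix.conjTranspose_eq_transpose_of_trivial]
    exact (Matrix.toLpLin_mul 2 2 2 _ _).symm
  have hchar : (LinearMap.adjoint T ∘ₗ T).charpoly =
      (Matrix.diagonal (fun j : Fin n => if (j : ℕ) < m then σ j ^ 2 else 0)).charpoly := by
    rw [hcomp, Matrix.charpoly_toLin, h.gram, Matrix.mul_assoc,
      Matrix.charpoly_mul_comm, Matrix.mul_assoc, h.right, Matrix.mul_one]
  have hroots := T.isSymmetric_adjoint_comp_self.roots_charpoly_eq_eigenvalues hn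
  rw [hchar, Matrix.charpoly_diagonal, Polynomial.roots_prod _ _ (by
      simp [Finset.prod_ne_zero_iff, Polynomial.X_sub_C_ne_zero])] at hroots
  simp only [Polynomial.roots_X_sub_C, Multiset.bind_singleton, Fin.univ_val_map,
    Multiset.coe_eq_coe] at hroots
  have heq := List.ofFn_injective (List.Perm.eq_of_sortedGE h.antitone_sq.sortedGE_ofFn
    (T.isSymmetric_adjoint_comp_self.eigenvalues_antitone hn).sortedGE_ofFn hroots)
  have hin : i < n := by omega
  have him : i < m := by omega
  have h1 := T.sq_singularValues_of_lt hn hin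
  rw [← congrFun heq ⟨i, hin⟩] at h1
  simp only [him, if_true] at h1
  exact (sq_eq_sq₀ (T.singularValues_nonneg i) (h.nonneg i)).mp h1

lemma singularValues_eq_zero_iff (A : Matrix (Fin m) (Fin n) ℝ) (i : ℕ) :
    (Matrix.toEuclideanLin A).singularValues i = 0 ↔ A.rank ≤ i := by
  rw [LinearMap.singularValues_eq_zero_iff_le_finrank_range, Matrix.rank_eq_finrank_range_toLin A
    (PiLp.basisFun 2 ℝ (Fin m)) (PiLp.basisFun 2 ℝ (Fin n))]
  rfl

lemma eq_zero_iff (h : IsSVD A U V σ) {i : ℕ} (hi : i < min m n) : σ i = 0 ↔ A.rank ≤ i := by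
  rw [← h.singularValues_eq hi, singularValues_eq_zero_iff]

lemma rank_trunc_le (h : IsSVD A U V σ) (r : ℕ) :
    (U * rectDiag m n (fun i => if i < r then σ i else 0) * Vᵀ).rank ≤ r := by
  by_cases hr : r < min m n
  · rw [← (h.trunc r).eq_zero_iff hr]
    simp
  · have h1 := Matrix.rank_le_width (U * rectDiag m n (fun i => if i < r then σ i else 0) * Vᵀ)
    have h2 := Matrix.rank_le_height (U * rectDiag m n (fun i => if i < r then σ i else 0) * Vᵀ)
    omega

lemma trunc_eq_self (h : IsSVD A U V σ) {r : ℕ} (hr : A.rank ≤ r) :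
    U * rectDiag m n (fun i => if i < r then σ i else 0) * Vᵀ = A := by
  conv_rhs => rw [h.eq]
  congr 2
  refine rectDiag_congr fun i hi => ?_
  split_ifs with hir
  · rfl
  · exact ((h.eq_zero_iff hi).mpr (by omega)).symm

end IsSVD

/-- A down-closed set contains `Iic i` if `i` is a member and lies in `Iio i` otherwise, so counting
decides membership. It turns a trace computation into a statement about the first `r` singular
vectors. -/
lemma Fin.mem_iff_lt_of_isLowerSet {S : Finset (Fin n)} (hS : ∀ i j, i ≤ j → j ∈ S → i ∈ S)
    (i : Fin n) : i ∈ S ↔ (i : ℕ) < S.card := by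
  constructor
  · intro hi
    have : Finset.Iic i ⊆ S := fun j hj => hS j i (Finset.mem_Iic.mp hj) hi
    have := Finset.card_le_card this
    rw [Fin.card_Iic] at this
    omega
  · intro hi
    by_contra hn
    have : S ⊆ Finset.Iio i := fun j hj => by
      rw [Finset.mem_Iio]
      by_contra hij
      exact hn (hS i j (not_lt.mp hij) hj)
    have := Finset.card_le_card this
    rw [Fin.card_Iio] at this
    omega

namespace IsPerceptionCompatible

variable {f : Set (Triple m n) → Matrix (Fin m) (Fin n) ℝ}

lemma exists_isSVD (hf : IsPerceptionCompatible f) (A : Matrix (Fin m) (Fin n) ℝ) {r : ℕ}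
    (h1 : 1 ≤ r) (h2 : r ≤ min m n) :
    ∃ U V σ, IsSVD A U V σ ∧ f (truncatedSVDs A r) =
      U * rectDiag m n (fun i => if i < r then σ i else 0) * Vᵀ := by
  obtain ⟨⟨U, S, V⟩, ⟨hU, hV, σ, ha, hn, hA, hS⟩, he⟩ := hf.mem A r h1 h2
  refine ⟨U, V, σ, ⟨hU, hV, ha, hn, hA⟩, ?_⟩
  rw [← he, Triple.toMatrix]
  dsimp only at hS ⊢
  rw [hS]

lemma rank_le (hf : IsPerceptionCompatible f) (A : Matrix (Fin m) (Fin n) ℝ) {r : ℕ}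
    (h1 : 1 ≤ r) (h2 : r ≤ min m n) : (f (truncatedSVDs A r)).rank ≤ r := by
  obtain ⟨U, V, σ, h, he⟩ := hf.exists_isSVD A h1 h2
  rw [he]
  exact h.rank_trunc_le r

/-- When the discarded singular values are all zero, every truncated SVD represents `A`, so the
choice function has no freedom. -/
lemma eq_self (hf : IsPerceptionCompatible f) {A : Matrix (Fin m) (Fin n) ℝ} {r : ℕ}
    (h1 : 1 ≤ r) (h2 : r ≤ min m n) (hr : A.rank ≤ r) : f (truncatedSVDs A r) = A := by
  obtain ⟨U, V, σ, h, he⟩ := hf.exists_isSVD A h1 h2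
  rw [he, h.trunc_eq_self hr]

end IsPerceptionCompatible

/-! ### Truncating a rank-one perturbation -/

lemma dotProduct_conj_diagonal (V : Matrix (Fin n) (Fin n) ℝ) (d : Fin n → ℝ) (w : Fin n → ℝ) :
    w ⬝ᵥ ((V * Matrix.diagonal d * Vᵀ) *ᵥ w) = ∑ j, d j * (Vᵀ *ᵥ w) j ^ 2 := by
  rw [← Matrix.mulVec_mulVec, ← Matrix.mulVec_mulVec, Matrix.dotProduct_mulVec,
    ← Matrix.mulVec_transpose]
  simp only [dotProduct, Matrix.mulVec_diagonal]
  exact Finset.sum_congr rfl fun j _ => by ring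

lemma mulVec_dotProduct_mulVec {k : ℕ} (A : Matrix (Fin m) (Fin n) ℝ) (B : Matrix (Fin m) (Fin k) ℝ)
    (x : Fin n → ℝ) (y : Fin k → ℝ) : (A *ᵥ x) ⬝ᵥ (B *ᵥ y) = x ⬝ᵥ ((Aᵀ * B) *ᵥ y) := by
  rw [← Matrix.mulVec_mulVec, Matrix.dotProduct_mulVec x, Matrix.vecMul_transpose]

lemma vecMulVec_zero' (a : Fin m → ℝ) : Matrix.vecMulVec a (0 : Fin n → ℝ) = 0 := by
  ext i j
  simp [Matrix.vecMulVec_apply]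

lemma dotProduct_sq_le (a b : Fin n → ℝ) : (a ⬝ᵥ b) ^ 2 ≤ (a ⬝ᵥ a) * (b ⬝ᵥ b) := by
  simp only [dotProduct, ← pow_two]
  exact Finset.sum_mul_sq_le_sq_mul_sq _ _ _

lemma dotProduct_self_nonneg' (a : Fin n → ℝ) : 0 ≤ a ⬝ᵥ a :=
  Finset.sum_nonneg fun _ _ => mul_self_nonneg _

/-- Truncation forgets a perturbation that is orthogonal to `A` and smaller than the least
singular value kept. -/
theorem IsSVD.trunc_add_smul_vecMulVec {A : Matrix (Fin m) (Fin n) ℝ}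
    {U U' : Matrix (Fin m) (Fin m) ℝ} {V V' : Matrix (Fin n) (Fin n) ℝ} {σ σ' : ℕ → ℝ}
    {a : Fin m → ℝ} {b : Fin n → ℝ} {r : ℕ} {s : ℝ}
    (h : IsSVD A U V σ) (h1 : 1 ≤ r) (h2 : r ≤ min m n) (hr : A.rank ≤ r)
    (hs : |s| < σ (r - 1)) (ha : a ⬝ᵥ a = 1) (hb : b ⬝ᵥ b = 1)
    (hAb : A *ᵥ b = 0) (haA : Aᵀ *ᵥ a = 0)
    (h' : IsSVD (A + s • Matrix.vecMulVec a b) U' V' σ') :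
    U' * rectDiag m n (fun i => if i < r then σ' i else 0) * V'ᵀ = A := by
  set u := A + s • Matrix.vecMulVec a b with hu
  set D : Matrix (Fin n) (Fin n) ℝ :=
    Matrix.diagonal (fun j : Fin n => if (j : ℕ) < r then (1 : ℝ) else 0) with hD
  set P := V * D * Vᵀ with hP
  have hDD : D * D = D := by
    rw [hD, Matrix.diagonal_mul_diagonal]
    congr 1
    ext j
    split_ifs <;> simp
  have hPt : Pᵀ = P := by
    simp [hP, hD, Matrix.transpose_mul, Matrix.mul_assoc]
  have hPP : P * P = P := by
    calc P * P = V * (D * (Vᵀ * V) * D) * Vᵀ := by simp only [hP, Matrix.mul_assoc]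
      _ = P := by rw [h.right, Matrix.mul_one, hDD]
  have hAP : A * P = A := by
    calc A * P = U * (rectDiag m n σ * (Vᵀ * V) * D) * Vᵀ := by
          rw [hP]; conv_lhs => rw [h.eq]
          simp only [Matrix.mul_assoc]
      _ = A := by rw [h.right, Matrix.mul_one, hD, rectDiag_mul_diagonal, h.trunc_eq_self hr]
  have hPb : P *ᵥ b = 0 := by
    have hτ : 0 < σ (r - 1) := (abs_nonneg s).trans_lt hs
    have hq := dotProduct_conj_diagonal V
      (fun j : Fin n => if (j : ℕ) < m then σ j ^ 2 else 0) b
    rw [← h.gram, ← Matrix.mulVec_mulVec, hAb, Matrix.mulVec_zero, dotProduct_zero] at hq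
    have hz : ∀ j : Fin n, (j : ℕ) < r → (Vᵀ *ᵥ b) j = 0 := by
      intro j hj
      have hj' := (Finset.sum_eq_zero_iff_of_nonneg (fun i _ => by
        split_ifs <;> positivity)).mp hq.symm j (Finset.mem_univ _)
      have : 0 < σ j := hτ.trans_le (h.anti (by omega))
      have hjm : (j : ℕ) < m := by omega
      simpa [hjm, this.ne'] using hj'
    rw [hP, ← Matrix.mulVec_mulVec, ← Matrix.mulVec_mulVec]
    suffices D *ᵥ Vᵀ *ᵥ b = 0 by rw [this, Matrix.mulVec_zero]
    ext j
    rw [hD, Matrix.mulVec_diagonal]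
    split_ifs with hj
    · simp [hz j hj]
    · simp
  have htrace : P.trace = r := by
    rw [hP, Matrix.trace_mul_comm, ← Matrix.mul_assoc, h.right, Matrix.one_mul, hD,
      Matrix.trace_diagonal, Finset.sum_boole]
    norm_cast
    rw [Fin.card_filter_val_lt]
    omega
  set μ : Fin n → ℝ := fun j => if (j : ℕ) < m then σ' j ^ 2 else 0
  set v : Fin n → Fin n → ℝ := fun i => V'.col i
  -- `q i` is the squared length of the projection to the row space of `A` of the `i`-th right
  -- singular vector of `u`; `μ i` is its eigenvalue for `uᵀu`.
  set q : Fin n → ℝ := fun i => v i ⬝ᵥ (P *ᵥ v i) with hq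
  have huP : u * P = A := by
    rw [hu, Matrix.add_mul, hAP, Matrix.smul_mul, Matrix.vecMulVec_mul, ← Matrix.mulVec_transpose,
      hPt, hPb, vecMulVec_zero']
    simp
  have huA : uᵀ * A = Aᵀ * A := by
    rw [hu, Matrix.transpose_add, Matrix.transpose_smul, Matrix.transpose_vecMulVec,
      Matrix.add_mul, Matrix.smul_mul, Matrix.vecMulVec_mul, ← Matrix.mulVec_transpose, haA,
      vecMulVec_zero']
    simp
  have hvv : ∀ i, v i ⬝ᵥ v i = 1 := fun i => by
    have := congrFun (congrFun h'.right i) i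
    rwa [Matrix.one_apply_eq] at this
  have hG : ∀ i, (uᵀ * u) *ᵥ v i = μ i • v i := fun i => by
    have : (uᵀ * u) * V' = V' * Matrix.diagonal μ := by
      rw [h'.gram, Matrix.mul_assoc, h'.right, Matrix.mul_one]
    ext k
    have := congrFun (congrFun this k) i
    rw [Matrix.mul_diagonal] at this
    rw [Pi.smul_apply, smul_eq_mul, mul_comm]
    exact this
  have hu_v : ∀ i, u *ᵥ v i = A *ᵥ v i + (s * (b ⬝ᵥ v i)) • a := fun i => by
    rw [hu, Matrix.add_mulVec, Matrix.smul_mulVec, Matrix.vecMulVec_mulVec]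
    simp [smul_smul]
  have hAA : ∀ i, (A *ᵥ v i) ⬝ᵥ (A *ᵥ v i) = μ i * q i := fun i => by
    calc (A *ᵥ v i) ⬝ᵥ (A *ᵥ v i) = v i ⬝ᵥ ((uᵀ * u * P) *ᵥ v i) := by
          rw [Matrix.mul_assoc, huP, huA, mulVec_dotProduct_mulVec]
      _ = ((uᵀ * u) *ᵥ v i) ⬝ᵥ (P *ᵥ v i) := by
          rw [← Matrix.mulVec_mulVec, Matrix.dotProduct_mulVec (v i), ← Matrix.mulVec_transpose]
          simp only [Matrix.transpose_mul, Matrix.transpose_transpose]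
      _ = μ i * q i := by rw [hG, smul_dotProduct, smul_eq_mul]
  -- On the row space, `A` stretches by at least `σ (r - 1)`.
  have hlow : ∀ i, σ (r - 1) ^ 2 * q i ≤ μ i * q i := fun i => by
    rw [← hAA, mulVec_dotProduct_mulVec, h.gram, dotProduct_conj_diagonal]
    simp only [hq, hP, hD, dotProduct_conj_diagonal, Finset.mul_sum]
    refine Finset.sum_le_sum fun j _ => ?_
    rw [← mul_assoc]
    refine mul_le_mul_of_nonneg_right ?_ (sq_nonneg _)
    have h3 := sq_nonneg (σ j)
    by_cases hj : (j : ℕ) < r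
    · have hjm : (j : ℕ) < m := by omega
      simp only [hj, hjm, if_true, mul_one]
      exact pow_le_pow_left₀ (h.nonneg _) (h.anti (by omega)) 2
    · simp only [hj, if_false, mul_zero]
      split_ifs <;> first | assumption | exact le_rfl
  have hPq : ∀ i, (P *ᵥ v i) ⬝ᵥ (P *ᵥ v i) = q i := fun i => by
    rw [mulVec_dotProduct_mulVec, hPt, hPP]
  have hres : ∀ i, (v i - P *ᵥ v i) ⬝ᵥ (v i - P *ᵥ v i) = 1 - q i := fun i => by
    rw [sub_dotProduct, dotProduct_sub, dotProduct_sub, hPq, hvv, dotProduct_comm (P *ᵥ v i)]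
    ring
  have hbv : ∀ i, b ⬝ᵥ v i = b ⬝ᵥ (v i - P *ᵥ v i) := fun i => by
    rw [dotProduct_sub, Matrix.dotProduct_mulVec, ← Matrix.mulVec_transpose, hPt, hPb,
      zero_dotProduct, sub_zero]
  -- Pythagoras for `u v = A v + s (b·v) a` leaves `s² (b·v)²`, and `b` only sees the part of `v`
  -- outside the row space.
  have hup : ∀ i, μ i * (1 - q i) ≤ s ^ 2 * (1 - q i) := fun i => by
    have e1 : (u *ᵥ v i) ⬝ᵥ (u *ᵥ v i) = μ i := by
      rw [mulVec_dotProduct_mulVec, hG,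
        dotProduct_smul, hvv, smul_eq_mul, mul_one]
    have e2 : (A *ᵥ v i) ⬝ᵥ a = 0 := by
      rw [dotProduct_comm, Matrix.dotProduct_mulVec, ← Matrix.mulVec_transpose, haA,
        zero_dotProduct]
    have e3 : μ i = μ i * q i + s ^ 2 * (b ⬝ᵥ v i) ^ 2 := by
      rw [← hAA, ← e1, hu_v]
      simp only [add_dotProduct, dotProduct_add, smul_dotProduct, dotProduct_smul, e2,
        dotProduct_comm a, ha, smul_eq_mul]
      ring
    have e4 := dotProduct_sq_le b (v i - P *ᵥ v i)
    rw [← hbv, hb, hres, one_mul] at e4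
    have e5 := mul_le_mul_of_nonneg_left e4 (sq_nonneg s)
    linarith
  have hss : s ^ 2 < σ (r - 1) ^ 2 := by
    rw [← sq_abs]
    exact pow_lt_pow_left₀ hs (abs_nonneg s) two_ne_zero
  have hq1 : ∀ i, q i ≤ 1 := fun i => by
    have := dotProduct_self_nonneg' (v i - P *ᵥ v i)
    rw [hres] at this
    linarith
  have hq01 : ∀ i, q i ≠ 1 → μ i ≤ s ^ 2 := fun i hi =>
    le_of_mul_le_mul_right (hup i) (by have := lt_of_le_of_ne (hq1 i) hi; linarith)
  -- If `0 < q i < 1`, both estimates apply and give `σ (r - 1)² ≤ μ i ≤ s²`, which is impossible.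
  -- So each singular vector lies inside the row space or is orthogonal to it.
  have hq0 : ∀ i, q i ≠ 1 → q i = 0 := fun i hi => by
    by_contra hne
    have hpos : 0 ≤ q i := by
      have := dotProduct_self_nonneg' (P *ᵥ v i)
      rwa [hPq] at this
    have := le_of_mul_le_mul_right (hlow i) (lt_of_le_of_ne hpos (Ne.symm hne))
    linarith [hq01 i hi]
  have hcard : (Finset.univ.filter fun i => q i = 1).card = r := by
    have e1 : ∑ i, q i = r := by
      rw [← htrace]
      calc ∑ i, q i = (V'ᵀ * (P * V')).trace := rfl
        _ = P.trace := by
          rw [Matrix.trace_mul_comm, Matrix.mul_assoc, h'.right', Matrix.mul_one]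
    have e2 : ∑ i, q i = ∑ i, if q i = 1 then (1 : ℝ) else 0 := by
      refine Finset.sum_congr rfl fun i _ => ?_
      split_ifs with hi
      · exact hi
      · exact hq0 i hi
    rw [e2, Finset.sum_boole] at e1
    exact_mod_cast e1
  -- Vectors inside the row space have `μ ≥ σ (r - 1)²`, the others `μ ≤ s²`; as `μ` decreases, the
  -- former come first, and the trace of `P` counts `r` of them.
  have hmem : ∀ i : Fin n, q i = 1 ↔ (i : ℕ) < r := fun i => by
    have := Fin.mem_iff_lt_of_isLowerSet (S := Finset.univ.filter fun i => q i = 1) (by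
      intro i j hij hj
      simp only [Finset.mem_filter, Finset.mem_univ, true_and] at hj ⊢
      by_contra hi
      have e1 := hq01 i hi
      have e2 := hlow j
      rw [hj, mul_one, mul_one] at e2
      have e3 : μ j ≤ μ i := h'.antitone_sq hij
      linarith) i
    rwa [hcard, Finset.mem_filter, and_iff_right (Finset.mem_univ _)] at this
  have hPV : P * V' = V' * D := by
    ext k i
    rw [hD, Matrix.mul_diagonal]
    change (P *ᵥ v i) k = v i k * _
    split_ifs with hi
    · have := hres i
      rw [(hmem i).mpr hi, sub_self, dotProduct_self_eq_zero, sub_eq_zero] at this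
      rw [← this, mul_one]
    · have e0 : (P *ᵥ v i) ⬝ᵥ (P *ᵥ v i) = 0 := by
        rw [hPq]
        exact hq0 i (mt (hmem i).mp hi)
      rw [dotProduct_self_eq_zero] at e0
      rw [e0, mul_zero, Pi.zero_apply]
  rw [← rectDiag_mul_diagonal, ← hD]
  calc U' * (rectDiag m n σ' * D) * V'ᵀ
      = U' * rectDiag m n σ' * (V'ᵀ * V') * D * V'ᵀ := by
        rw [h'.right, Matrix.mul_one]
        simp only [Matrix.mul_assoc]
    _ = U' * rectDiag m n σ' * V'ᵀ * (V' * D * V'ᵀ) := by simp only [Matrix.mul_assoc]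
    _ = A := by
        rw [← h'.eq, ← hPV, Matrix.mul_assoc P, h'.right', Matrix.mul_one, huP]

/-! ### Projections onto null spaces -/

/-- `Q` is the orthogonal projection onto the null space of `A`. -/
structure IsKerProj (A : Matrix (Fin m) (Fin n) ℝ) (Q : Matrix (Fin n) (Fin n) ℝ) : Prop where
  symm : Qᵀ = Q
  mul_zero : A * Q = 0
  fix : ∀ z : Fin n → ℝ, A *ᵥ z = 0 → Q *ᵥ z = z

namespace IsKerProj

variable {A : Matrix (Fin m) (Fin n) ℝ} {Q : Matrix (Fin n) (Fin n) ℝ}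

lemma mul_eq (h : IsKerProj A Q) {k : ℕ} {E : Matrix (Fin n) (Fin k) ℝ} (hE : A * E = 0) :
    Q * E = E := by
  ext i j
  have : A *ᵥ E.col j = 0 := funext fun l => congrFun (congrFun hE l) j
  exact congrFun (h.fix _ this) i

lemma idem (h : IsKerProj A Q) : Q * Q = Q := h.mul_eq h.mul_zero

lemma mulVec_zero (h : IsKerProj A Q) (z : Fin n → ℝ) : A *ᵥ (Q *ᵥ z) = 0 := by
  rw [Matrix.mulVec_mulVec, h.mul_zero, Matrix.zero_mulVec]

lemma dotProduct_mulVec (h : IsKerProj A Q) (z : Fin n → ℝ) :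
    z ⬝ᵥ (Q *ᵥ z) = (Q *ᵥ z) ⬝ᵥ (Q *ᵥ z) := by
  rw [mulVec_dotProduct_mulVec, h.symm, h.idem]

lemma of_isNullBasis {k : ℕ} {N : Matrix (Fin n) (Fin k) ℝ} (h : IsNullBasis A N) :
    IsKerProj A (N * Nᵀ) where
  symm := by simp
  mul_zero := by
    have : A * N = 0 := by
      ext i j
      exact congrFun ((h.2 (N.col j)).mpr (Submodule.subset_span ⟨j, rfl⟩)) i
    rw [← Matrix.mul_assoc, this, Matrix.zero_mul]
  fix z hz := by
    rw [h.2, ← Matrix.range_mulVecLin] at hz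
    obtain ⟨w, rfl⟩ := hz
    rw [Matrix.mulVecLin_apply, Matrix.mulVec_mulVec, Matrix.mul_assoc, h.1, Matrix.mul_one]

end IsKerProj

/-- `A` and `AᵀA` have the same null space, spanned by the columns of `V` with Gram eigenvalue zero.
-/
lemma IsSVD.exists_isKerProj {A : Matrix (Fin m) (Fin n) ℝ} {U : Matrix (Fin m) (Fin m) ℝ}
    {V : Matrix (Fin n) (Fin n) ℝ} {σ : ℕ → ℝ} (h : IsSVD A U V σ) : ∃ Q, IsKerProj A Q := by
  set g : Fin n → ℝ := fun j => if (j : ℕ) < m then σ j ^ 2 else 0 with hg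
  set D : Matrix (Fin n) (Fin n) ℝ := Matrix.diagonal fun j => if g j = 0 then (1 : ℝ) else 0
    with hD
  refine ⟨V * D * Vᵀ, by simp [hD, Matrix.mul_assoc], ?_, fun z hz => ?_⟩
  · rw [← Matrix.conjTranspose_mul_self_mul_eq_zero, Matrix.conjTranspose_eq_transpose_of_trivial,
      h.gram]
    calc V * Matrix.diagonal g * Vᵀ * (V * D * Vᵀ)
        = V * (Matrix.diagonal g * (Vᵀ * V) * D) * Vᵀ := by simp only [Matrix.mul_assoc]
      _ = 0 := by
        rw [h.right, Matrix.mul_one, hD, Matrix.diagonal_mul_diagonal]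
        have : ∀ j, g j * (if g j = 0 then (1 : ℝ) else 0) = 0 := fun j => by
          split_ifs with hj <;> simp [hj]
        simp only [this, Matrix.diagonal_zero, Matrix.mul_zero, Matrix.zero_mul]
  · have h0 : (V * Matrix.diagonal g * Vᵀ) *ᵥ z = 0 := by
      rw [← h.gram, ← Matrix.mulVec_mulVec, hz, Matrix.mulVec_zero]
    have h1 : Matrix.diagonal g *ᵥ (Vᵀ *ᵥ z) = 0 := by
      have := congrArg (Vᵀ *ᵥ ·) h0
      simpa only [Matrix.mulVec_mulVec, ← Matrix.mul_assoc, h.right, Matrix.one_mul,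
        Matrix.mulVec_zero] using this
    have h2 : D *ᵥ (Vᵀ *ᵥ z) = Vᵀ *ᵥ z := by
      ext j
      have := congrFun h1 j
      rw [Matrix.mulVec_diagonal, Pi.zero_apply, mul_eq_zero] at this
      rw [hD, Matrix.mulVec_diagonal]
      split_ifs with hj
      · rw [one_mul]
      · rw [this.resolve_left hj, mul_zero]
    rw [← Matrix.mulVec_mulVec, ← Matrix.mulVec_mulVec, h2, Matrix.mulVec_mulVec, h.right',
      Matrix.one_mulVec]

lemma norm2_sq {k : ℕ} (v : Fin k → ℝ) : norm2 v ^ 2 = v ⬝ᵥ v := by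
  rw [norm2, EuclideanSpace.real_norm_sq_eq]
  simp [dotProduct, pow_two]

lemma norm2_nonneg {k : ℕ} (v : Fin k → ℝ) : 0 ≤ norm2 v := norm_nonneg _

lemma norm2_mulVec_of_orthonormal {k : ℕ} {N : Matrix (Fin n) (Fin k) ℝ} (h : Nᵀ * N = 1)
    (w : Fin k → ℝ) : norm2 (N *ᵥ w) = norm2 w := by
  rw [← sq_eq_sq₀ (norm2_nonneg _) (norm2_nonneg _), norm2_sq, norm2_sq, mulVec_dotProduct_mulVec,
    h, Matrix.one_mulVec]

/-! ### The part discarded by truncation -/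

namespace IsSVD

variable {u : Matrix (Fin m) (Fin n) ℝ} {U : Matrix (Fin m) (Fin m) ℝ}
  {V : Matrix (Fin n) (Fin n) ℝ} {σ : ℕ → ℝ}

lemma sub_trunc (h : IsSVD u U V σ) (r : ℕ) :
    u - U * rectDiag m n (fun i => if i < r then σ i else 0) * Vᵀ =
      U * rectDiag m n (fun i => if i < r then 0 else σ i) * Vᵀ := by
  conv_lhs => rw [h.eq]
  rw [← Matrix.sub_mul, ← Matrix.mul_sub]
  congr 2
  ext i j
  simp only [rectDiag, Matrix.sub_apply, Matrix.of_apply]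
  split_ifs <;> simp

lemma transpose_trunc_mul_sub (h : IsSVD u U V σ) (r : ℕ) :
    (U * rectDiag m n (fun i => if i < r then σ i else 0) * Vᵀ)ᵀ *
      (u - U * rectDiag m n (fun i => if i < r then σ i else 0) * Vᵀ) = 0 := by
  rw [h.sub_trunc]
  set S := rectDiag m n (fun i => if i < r then σ i else 0) with hS
  set S' := rectDiag m n (fun i => if i < r then 0 else σ i) with hS'
  calc (U * S * Vᵀ)ᵀ * (U * S' * Vᵀ) = V * (Sᵀ * (Uᵀ * U) * S') * Vᵀ := by
        simp only [Matrix.transpose_mul, Matrix.transpose_transpose, Matrix.mul_assoc]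
    _ = 0 := by
      rw [h.left, Matrix.mul_one, hS, hS', rectDiag_transpose_mul]
      convert Matrix.zero_mul (M := Vᵀ) using 2
      convert Matrix.mul_zero V
      rw [← Matrix.diagonal_zero]
      congr 1
      ext j
      split_ifs <;> simp

lemma trunc_mul_transpose_sub (h : IsSVD u U V σ) (r : ℕ) :
    (U * rectDiag m n (fun i => if i < r then σ i else 0) * Vᵀ) *
      (u - U * rectDiag m n (fun i => if i < r then σ i else 0) * Vᵀ)ᵀ = 0 := by
  have := h.transpose.transpose_trunc_mul_sub r
  rw [← rectDiag_transpose] at this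
  simpa only [Matrix.transpose_mul, Matrix.transpose_sub, Matrix.transpose_transpose,
    Matrix.mul_assoc] using this

/-- The bound uses the last kept value `σ (r - 1)` rather than the first discarded `σ r`, since only
the former can be read off from the truncated matrix. -/
lemma sub_trunc_mulVec_le (h : IsSVD u U V σ) (r : ℕ) (z : Fin n → ℝ) :
    ((u - U * rectDiag m n (fun i => if i < r then σ i else 0) * Vᵀ) *ᵥ z) ⬝ᵥ
      ((u - U * rectDiag m n (fun i => if i < r then σ i else 0) * Vᵀ) *ᵥ z) ≤
      σ (r - 1) ^ 2 * (z ⬝ᵥ z) := by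
  rw [h.sub_trunc, mulVec_dotProduct_mulVec]
  set S' := rectDiag m n (fun i => if i < r then 0 else σ i) with hS'
  have e1 : (U * S' * Vᵀ)ᵀ * (U * S' * Vᵀ) = V * (S'ᵀ * S') * Vᵀ := by
    calc (U * S' * Vᵀ)ᵀ * (U * S' * Vᵀ) = V * (S'ᵀ * (Uᵀ * U) * S') * Vᵀ := by
          simp only [Matrix.transpose_mul, Matrix.transpose_transpose, Matrix.mul_assoc]
      _ = _ := by rw [h.left, Matrix.mul_one]
  have e2 : z ⬝ᵥ z = (Vᵀ *ᵥ z) ⬝ᵥ (Vᵀ *ᵥ z) := by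
    rw [mulVec_dotProduct_mulVec, Matrix.transpose_transpose, h.right', Matrix.one_mulVec]
  rw [e1, hS', rectDiag_transpose_mul, dotProduct_conj_diagonal, e2, dotProduct, Finset.mul_sum]
  refine Finset.sum_le_sum fun j _ => ?_
  rw [← pow_two ((Vᵀ *ᵥ z) j)]
  refine mul_le_mul_of_nonneg_right ?_ (sq_nonneg _)
  have h0 : 0 ≤ σ (r - 1) ^ 2 := sq_nonneg _
  by_cases hj : (j : ℕ) < r
  · simpa [hj] using h0
  · have := pow_le_pow_left₀ (h.nonneg j) (h.anti (show r - 1 ≤ j by omega)) 2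
    by_cases hjm : (j : ℕ) < m
    · simpa [hj, hjm, ← pow_two] using this
    · simpa [hjm] using h0

end IsSVD

/-! ### Perception in terms of rank, and residuals -/

lemma sigma_nonneg (A : Matrix (Fin m) (Fin n) ℝ) (c : ℕ∞) : 0 ≤ sigma A c := by
  rw [sigma]
  split_ifs
  · exact le_rfl
  · exact LinearMap.singularValues_nonneg _ _

lemma sigma_eq_zero {A : Matrix (Fin m) (Fin n) ℝ} {c : ℕ∞} (h : (A.rank : ℕ∞) < c) :
    sigma A c = 0 := by
  rw [sigma]
  split_ifs with hc
  · rfl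
  · lift c to ℕ using hc
    rw [IsSVD.singularValues_eq_zero_iff, ENat.toNat_natCast]
    have : A.rank < c := by exact_mod_cast h
    omega

lemma IsSVD.sigma_eq {A : Matrix (Fin m) (Fin n) ℝ} {U : Matrix (Fin m) (Fin m) ℝ}
    {V : Matrix (Fin n) (Fin n) ℝ} {σ : ℕ → ℝ} (h : IsSVD A U V σ) {r : ℕ} (h1 : 1 ≤ r)
    (h2 : r ≤ min m n) : sigma A r = σ (r - 1) := by
  rw [sigma, if_neg (ENat.natCast_ne_top r), ENat.toNat_natCast, h.singularValues_eq (by omega)]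

lemma rank_le_min (A : Matrix (Fin m) (Fin n) ℝ) : A.rank ≤ min m n :=
  le_min A.rank_le_height A.rank_le_width

lemma rank_add_le (A B : Matrix (Fin m) (Fin n) ℝ) : (A + B).rank ≤ A.rank + B.rank := by
  rw [Matrix.rank, Matrix.mulVecLin_add]
  exact (Submodule.finrank_mono (LinearMap.range_add_le _ _)).trans
    (Submodule.finrank_add_le_finrank_add_finrank _ _)

namespace IsPerceptionCompatible

variable {f : Set (Triple m n) → Matrix (Fin m) (Fin n) ℝ} {c : ℕ∞}

lemma perception_coe {r : ℕ} (hr : r ≤ min m n) (A : Matrix (Fin m) (Fin n) ℝ) :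
    lowRankPerception f A r = f (truncatedSVDs A r) := by
  rw [lowRankPerception, min_eq_left (by exact_mod_cast hr), ENat.toNat_natCast]

lemma perception_of_le (hf : IsPerceptionCompatible f) (hc : ((min m n : ℕ) : ℕ∞) ≤ c)
    (A : Matrix (Fin m) (Fin n) ℝ) : lowRankPerception f A c = A := by
  rw [lowRankPerception, min_eq_right hc, ENat.toNat_natCast]
  rcases Nat.eq_zero_or_pos (min m n) with h0 | h0
  -- Here the truncation level is `0`, where nothing is assumed about `f`, but there is only one
  -- matrix.
  · have : m = 0 ∨ n = 0 := by omega
    rcases this with rfl | rfl <;> exact Subsingleton.elim _ _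
  · exact hf.eq_self h0 le_rfl (rank_le_min A)

lemma cases_capability (hc : 1 ≤ c) :
    ((min m n : ℕ) : ℕ∞) < c ∨ ∃ r : ℕ, c = r ∧ 1 ≤ r ∧ r ≤ min m n := by
  rcases lt_or_ge ((min m n : ℕ) : ℕ∞) c with h | h
  · exact Or.inl h
  · lift c to ℕ using ne_top_of_le_ne_top (ENat.natCast_ne_top _) h
    exact Or.inr ⟨c, rfl, by exact_mod_cast hc, by exact_mod_cast h⟩

lemma perception_eq_self_iff (hf : IsPerceptionCompatible f) (hc : 1 ≤ c)
    (A : Matrix (Fin m) (Fin n) ℝ) : lowRankPerception f A c = A ↔ (A.rank : ℕ∞) ≤ c := by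
  rcases cases_capability (m := m) (n := n) hc with h | ⟨r, rfl, h1, h2⟩
  · exact iff_of_true (hf.perception_of_le h.le A)
      (le_trans (by exact_mod_cast rank_le_min A) h.le)
  · rw [perception_coe h2, Nat.cast_le]
    exact ⟨fun h => h ▸ hf.rank_le A h1 h2, hf.eq_self h1 h2⟩

lemma rank_perception_le (hf : IsPerceptionCompatible f) (hc : 1 ≤ c)
    (A : Matrix (Fin m) (Fin n) ℝ) : ((lowRankPerception f A c).rank : ℕ∞) ≤ c := by
  rcases cases_capability (m := m) (n := n) hc with h | ⟨r, rfl, h1, h2⟩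
  · exact le_trans (by exact_mod_cast rank_le_min _) h.le
  · rw [perception_coe h2, Nat.cast_le]
    exact hf.rank_le A h1 h2

lemma intrinsicCapability_le_iff (hf : IsPerceptionCompatible f) (hc : 1 ≤ c)
    (A : Matrix (Fin m) (Fin n) ℝ) :
    intrinsicCapability (lowRankPerception f) A ≤ c ↔ (A.rank : ℕ∞) ≤ c := by
  constructor
  · intro h
    have hne : {c : ℕ∞ | 1 ≤ c ∧ lowRankPerception f A c = A}.Nonempty :=
      ⟨⊤, le_top, hf.perception_of_le le_top A⟩
    obtain ⟨h1, h2⟩ := csInf_mem hne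
    exact ((hf.perception_eq_self_iff h1 A).mp h2).trans h
  · intro h
    exact sInf_le ⟨hc, (hf.perception_eq_self_iff hc A).mpr h⟩

lemma mem_concretization_iff (hf : IsPerceptionCompatible f) (hc : 1 ≤ c)
    {A u : Matrix (Fin m) (Fin n) ℝ} (hA : (A.rank : ℕ∞) ≤ c) :
    u ∈ concretization (lowRankPerception f) A c ↔ lowRankPerception f u c = A := by
  rw [concretization, Set.mem_ofPred_eq, max_eq_right ((hf.intrinsicCapability_le_iff hc A).mpr hA)]

lemma residual (hf : IsPerceptionCompatible f) (hc : 1 ≤ c)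
    {A u : Matrix (Fin m) (Fin n) ℝ} (hu : lowRankPerception f u c = A) :
    Aᵀ * (u - A) = 0 ∧ A * (u - A)ᵀ = 0 ∧
      ∀ z, ((u - A) *ᵥ z) ⬝ᵥ ((u - A) *ᵥ z) ≤ sigma A c ^ 2 * (z ⬝ᵥ z) := by
  rcases cases_capability (m := m) (n := n) hc with h | ⟨r, rfl, h1, h2⟩
  · rw [hf.perception_of_le h.le] at hu
    subst hu
    simp only [sub_self, Matrix.mul_zero, Matrix.transpose_zero, Matrix.zero_mulVec,
      dotProduct_zero, true_and]
    exact fun z => mul_nonneg (sq_nonneg _) (dotProduct_self_nonneg' z)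
  · rw [perception_coe h2] at hu
    obtain ⟨U, V, σ, h, he⟩ := hf.exists_isSVD u h1 h2
    rw [he] at hu
    have hs := (h.trunc r).sigma_eq h1 h2
    rw [if_pos (by omega)] at hs
    subst hu
    rw [hs]
    exact ⟨h.transpose_trunc_mul_sub r, h.trunc_mul_transpose_sub r, h.sub_trunc_mulVec_le r⟩

lemma abs_residual_le (hf : IsPerceptionCompatible f) (hc : 1 ≤ c)
    {A u : Matrix (Fin m) (Fin n) ℝ} (hu : lowRankPerception f u c = A)
    {L : Matrix (Fin m) (Fin m) ℝ} {N : Matrix (Fin n) (Fin n) ℝ}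
    (hL : IsKerProj Aᵀ L) (hN : IsKerProj A N) (x : Fin m → ℝ) (y : Fin n → ℝ) :
    |x ⬝ᵥ (u *ᵥ y) - x ⬝ᵥ (A *ᵥ y)| ≤ sigma A c * norm2 (L *ᵥ x) * norm2 (N *ᵥ y) := by
  obtain ⟨h1, h2, h3⟩ := hf.residual hc hu
  have e : x ⬝ᵥ (u *ᵥ y) - x ⬝ᵥ (A *ᵥ y) = (L *ᵥ x) ⬝ᵥ ((u - A) *ᵥ (N *ᵥ y)) := by
    -- `A(u - A)ᵀ = 0` says that the rows of `u - A` lie in the null space of `A`, so `N` fixes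
    -- them.
    have e1 : (u - A) * N = u - A := by
      have := congrArg Matrix.transpose (hN.mul_eq h2)
      rwa [Matrix.transpose_mul, Matrix.transpose_transpose, hN.symm] at this
    rw [Matrix.mulVec_mulVec, e1, mulVec_dotProduct_mulVec, hL.symm, hL.mul_eq h1,
      Matrix.sub_mulVec, dotProduct_sub]
  rw [e]
  refine abs_le_of_sq_le_sq ?_ (by
    have := sigma_nonneg A c; have := norm2_nonneg (L *ᵥ x); have := norm2_nonneg (N *ᵥ y)
    positivity)
  calc _ ≤ _ := dotProduct_sq_le _ _
    _ ≤ (L *ᵥ x) ⬝ᵥ (L *ᵥ x) * (sigma A c ^ 2 * ((N *ᵥ y) ⬝ᵥ (N *ᵥ y))) :=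
      mul_le_mul_of_nonneg_left (h3 _) (dotProduct_self_nonneg' _)
    _ = _ := by rw [← norm2_sq, ← norm2_sq]; ring

lemma perception_add_smul_vecMulVec (hf : IsPerceptionCompatible f) (hc : 1 ≤ c)
    {A : Matrix (Fin m) (Fin n) ℝ} (hA : (A.rank : ℕ∞) ≤ c) {a : Fin m → ℝ} {b : Fin n → ℝ}
    {s : ℝ} (hs : |s| < sigma A c) (ha : a ⬝ᵥ a = 1) (hb : b ⬝ᵥ b = 1)
    (hAb : A *ᵥ b = 0) (haA : Aᵀ *ᵥ a = 0) :
    lowRankPerception f (A + s • Matrix.vecMulVec a b) c = A := by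
  rcases cases_capability (m := m) (n := n) hc with h | ⟨r, rfl, h1, h2⟩
  · rw [sigma_eq_zero (lt_of_le_of_lt (by exact_mod_cast rank_le_min A) h)] at hs
    exact absurd hs (abs_nonneg s).not_gt
  · obtain ⟨U, V, σ, h, -⟩ := hf.exists_isSVD A h1 h2
    obtain ⟨U', V', σ', h', he⟩ := hf.exists_isSVD (A + s • Matrix.vecMulVec a b) h1 h2
    rw [h.sigma_eq h1 h2] at hs
    rw [perception_coe h2, he]
    exact h.trunc_add_smul_vecMulVec h1 h2 (by exact_mod_cast hA) hs ha hb hAb haA h'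

end IsPerceptionCompatible

/-! ### Payoff bounds -/

lemma exists_unit_directions {A : Matrix (Fin m) (Fin n) ℝ}
    {L : Matrix (Fin m) (Fin m) ℝ} {N : Matrix (Fin n) (Fin n) ℝ}
    (hL : IsKerProj Aᵀ L) (hN : IsKerProj A N) {x : Fin m → ℝ} {y : Fin n → ℝ} {τ δ : ℝ}
    (hτ : 0 ≤ τ) (hδ : 0 < δ) (hne : τ * norm2 (L *ᵥ x) * norm2 (N *ᵥ y) ≠ 0) :
    ∃ (s : ℝ) (a : Fin m → ℝ) (b : Fin n → ℝ), 0 < s ∧ s < τ ∧ a ⬝ᵥ a = 1 ∧ b ⬝ᵥ b = 1 ∧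
      A *ᵥ b = 0 ∧ Aᵀ *ᵥ a = 0 ∧ L *ᵥ x = norm2 (L *ᵥ x) • a ∧
      τ * norm2 (L *ᵥ x) * norm2 (N *ᵥ y) - δ ≤ s * (x ⬝ᵥ a * b ⬝ᵥ y) := by
  have hX := norm2_sq (L *ᵥ x)
  have hY := norm2_sq (N *ᵥ y)
  have hxL := hL.dotProduct_mulVec x
  have hyN := hN.dotProduct_mulVec y
  have hLx := hL.mulVec_zero x
  have hNy := hN.mulVec_zero y
  have hX0 : 0 < norm2 (L *ᵥ x) :=
    lt_of_le_of_ne (norm2_nonneg _) (by rintro h; simp [← h] at hne)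
  have hY0 : 0 < norm2 (N *ᵥ y) :=
    lt_of_le_of_ne (norm2_nonneg _) (by rintro h; simp [← h] at hne)
  have hτ0 : 0 < τ := lt_of_le_of_ne hτ (by rintro h; simp [← h] at hne)
  set X := norm2 (L *ᵥ x)
  set Y := norm2 (N *ᵥ y)
  have hXY : 0 < X * Y := mul_pos hX0 hY0
  -- The second term costs at most `δ` after multiplication by `X * Y`; `τ / 2` keeps `s` positive
  -- when `δ` is large.
  refine ⟨max (τ / 2) (τ - δ / (X * Y)), X⁻¹ • (L *ᵥ x), Y⁻¹ • (N *ᵥ y),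
    lt_max_of_lt_left (by positivity), max_lt (by linarith) (by linarith [div_pos hδ hXY]),
    ?_, ?_, ?_, ?_, ?_, ?_⟩
  · rw [smul_dotProduct, dotProduct_smul, ← hX, smul_eq_mul, smul_eq_mul]
    field_simp
  · rw [smul_dotProduct, dotProduct_smul, ← hY, smul_eq_mul, smul_eq_mul]
    field_simp
  · rw [Matrix.mulVec_smul, hNy, smul_zero]
  · rw [Matrix.mulVec_smul, hLx, smul_zero]
  · rw [smul_smul, mul_inv_cancel₀ hX0.ne', one_smul]
  · have e1 : x ⬝ᵥ (X⁻¹ • (L *ᵥ x)) = X := by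
      rw [dotProduct_smul, hxL, ← hX, smul_eq_mul]; field_simp
    have e2 : (Y⁻¹ • (N *ᵥ y)) ⬝ᵥ y = Y := by
      rw [smul_dotProduct, dotProduct_comm, hyN, ← hY, smul_eq_mul]; field_simp
    rw [e1, e2]
    calc τ * X * Y - δ = (τ - δ / (X * Y)) * (X * Y) := by field_simp
      _ ≤ _ := mul_le_mul_of_nonneg_right (le_max_right _ _) hXY.le

lemma dotProduct_add_smul_vecMulVec (A : Matrix (Fin m) (Fin n) ℝ) (s : ℝ) (a x : Fin m → ℝ)
    (b y : Fin n → ℝ) : x ⬝ᵥ ((A + s • Matrix.vecMulVec a b) *ᵥ y) =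
      x ⬝ᵥ (A *ᵥ y) + s * (x ⬝ᵥ a * b ⬝ᵥ y) := by
  rw [Matrix.add_mulVec, Matrix.smul_mulVec, Matrix.vecMulVec_mulVec, dotProduct_add,
    dotProduct_smul, smul_eq_mul]
  simp [mul_comm]

lemma EReal.le_coe_of_forall_pos {X : EReal} {q : ℝ} (h : ∀ δ > 0, X ≤ ((q + δ : ℝ) : EReal)) :
    X ≤ q := by
  rw [← EReal.le_of_forall_lt_iff_le]
  intro z hz
  have := h (z - q) (sub_pos.mpr (by exact_mod_cast hz))
  rwa [add_sub_cancel] at this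

lemma EReal.coe_le_of_forall_pos {X : EReal} {q : ℝ} (h : ∀ δ > 0, ((q - δ : ℝ) : EReal) ≤ X) :
    (q : EReal) ≤ X := by
  rw [← EReal.ge_of_forall_gt_iff_ge]
  intro z hz
  have := h (q - z) (sub_pos.mpr (by exact_mod_cast hz))
  rwa [sub_sub_cancel] at this

namespace IsPerceptionCompatible

variable {f : Set (Triple m n) → Matrix (Fin m) (Fin n) ℝ} {c : ℕ∞}

theorem minPayoff_eq (hf : IsPerceptionCompatible f) (hc : 1 ≤ c)
    {A : Matrix (Fin m) (Fin n) ℝ} (hA : (A.rank : ℕ∞) ≤ c)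
    {L : Matrix (Fin m) (Fin m) ℝ} {N : Matrix (Fin n) (Fin n) ℝ}
    (hL : IsKerProj Aᵀ L) (hN : IsKerProj A N) (x : Fin m → ℝ) (y : Fin n → ℝ) :
    minPayoff (lowRankPerception f) A c x y =
      ((x ⬝ᵥ (A *ᵥ y) - sigma A c * norm2 (L *ᵥ x) * norm2 (N *ᵥ y) : ℝ) : EReal) := by
  refine le_antisymm (EReal.le_coe_of_forall_pos fun δ hδ => ?_) (le_iInf₂ fun u hu => ?_)
  -- If the correction vanishes, `A` itself attains the bound and the components need not be
  -- normalizable.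
  · by_cases h0 : sigma A c * norm2 (L *ᵥ x) * norm2 (N *ᵥ y) = 0
    · refine (iInf₂_le A ((hf.mem_concretization_iff hc hA).mpr
        ((hf.perception_eq_self_iff hc A).mpr hA))).trans (EReal.coe_le_coe_iff.mpr ?_)
      linarith
    · obtain ⟨s, a, b, hs, hs', ha, hb, hAb, haA, -, hle⟩ :=
        exists_unit_directions hL hN (sigma_nonneg A c) hδ h0
      refine (iInf₂_le (A + (-s) • Matrix.vecMulVec a b) ((hf.mem_concretization_iff hc hA).mpr
        (hf.perception_add_smul_vecMulVec hc hA (by rwa [abs_neg, abs_of_pos hs]) ha hb hAb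
          haA))).trans (EReal.coe_le_coe_iff.mpr ?_)
      rw [dotProduct_add_smul_vecMulVec]
      linarith
  · rw [hf.mem_concretization_iff hc hA] at hu
    have := neg_le_of_abs_le (hf.abs_residual_le hc hu hL hN x y)
    exact EReal.coe_le_coe_iff.mpr (by linarith)

theorem maxPayoff_eq (hf : IsPerceptionCompatible f) (hc : 1 ≤ c)
    {A : Matrix (Fin m) (Fin n) ℝ} (hA : (A.rank : ℕ∞) ≤ c)
    {L : Matrix (Fin m) (Fin m) ℝ} {N : Matrix (Fin n) (Fin n) ℝ}
    (hL : IsKerProj Aᵀ L) (hN : IsKerProj A N) (x : Fin m → ℝ) (y : Fin n → ℝ) :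
    maxPayoff (lowRankPerception f) A c x y =
      ((x ⬝ᵥ (A *ᵥ y) + sigma A c * norm2 (L *ᵥ x) * norm2 (N *ᵥ y) : ℝ) : EReal) := by
  refine le_antisymm (iSup₂_le fun u hu => ?_) (EReal.coe_le_of_forall_pos fun δ hδ => ?_)
  · rw [hf.mem_concretization_iff hc hA] at hu
    have := le_of_abs_le (hf.abs_residual_le hc hu hL hN x y)
    exact EReal.coe_le_coe_iff.mpr (by linarith)
  · by_cases h0 : sigma A c * norm2 (L *ᵥ x) * norm2 (N *ᵥ y) = 0
    · refine le_trans (EReal.coe_le_coe_iff.mpr ?_) (le_iSup₂_of_le A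
        ((hf.mem_concretization_iff hc hA).mpr ((hf.perception_eq_self_iff hc A).mpr hA)) le_rfl)
      linarith
    · obtain ⟨s, a, b, hs, hs', ha, hb, hAb, haA, -, hle⟩ :=
        exists_unit_directions hL hN (sigma_nonneg A c) hδ h0
      refine le_trans (EReal.coe_le_coe_iff.mpr ?_) (le_iSup₂_of_le (A + s • Matrix.vecMulVec a b)
        ((hf.mem_concretization_iff hc hA).mpr (hf.perception_add_smul_vecMulVec hc hA
          (by rwa [abs_of_pos hs]) ha hb hAb haA)) le_rfl)
      rw [dotProduct_add_smul_vecMulVec]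
      linarith

/-! ### Narrow reversibility -/

/-- Each `u'` is a possible true payoff for both players, so its own payoff lies between the two
sides. -/
lemma minPayoff_le_iInf (hf : IsPerceptionCompatible f) {c₁ c₂ : ℕ∞} (hc : 1 ≤ c₁)
    (hcc : c₁ ≤ c₂) {A : Matrix (Fin m) (Fin n) ℝ} (hA : (A.rank : ℕ∞) ≤ c₁)
    (x : Fin m → ℝ) (y : Fin n → ℝ) :
    minPayoff (lowRankPerception f) A c₁ x y ≤
      ⨅ u' ∈ narrowConcretization (lowRankPerception f) A c₁ c₂,
        maxPayoff (lowRankPerception f) u' c₂ x y := by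
  refine le_iInf₂ fun u' ⟨hu1, hu2⟩ => ?_
  have hc2 := hc.trans hcc
  rw [hf.intrinsicCapability_le_iff hc2] at hu1
  rw [min_eq_left hcc, (hf.perception_eq_self_iff hc A).mpr hA] at hu2
  exact (iInf₂_le u' ((hf.mem_concretization_iff hc hA).mpr hu2.symm)).trans
    (le_iSup₂_of_le u' ((hf.mem_concretization_iff hc2 hu1).mpr
      ((hf.perception_eq_self_iff hc2 u').mpr hu1)) le_rfl)

lemma mem_narrowConcretization_iff (hf : IsPerceptionCompatible f) {c₁ c₂ : ℕ∞} (hc : 1 ≤ c₁)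
    (hcc : c₁ ≤ c₂) {A u : Matrix (Fin m) (Fin n) ℝ} (hA : (A.rank : ℕ∞) ≤ c₁) :
    u ∈ narrowConcretization (lowRankPerception f) A c₁ c₂ ↔
      (u.rank : ℕ∞) ≤ c₂ ∧ lowRankPerception f u c₁ = A := by
  rw [narrowConcretization, Set.mem_ofPred_eq, hf.intrinsicCapability_le_iff (hc.trans hcc),
    min_eq_left hcc, (hf.perception_eq_self_iff hc A).mpr hA, eq_comm (a := A)]

/-- A payoff matrix that already uses the direction of the component of `x` in the null space
leaves no uncertainty about the payoff of `x`. -/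
lemma maxPayoff_add_smul_vecMulVec_le (hf : IsPerceptionCompatible f) (hc : 1 ≤ c)
    {A : Matrix (Fin m) (Fin n) ℝ} {a x : Fin m → ℝ} {b y : Fin n → ℝ} {s t : ℝ} (hs : s ≠ 0)
    {L : Matrix (Fin m) (Fin m) ℝ} (hL : IsKerProj Aᵀ L) (hb : b ⬝ᵥ b = 1)
    (hAb : A *ᵥ b = 0) (hx : L *ᵥ x = t • a)
    (hu : ((A + s • Matrix.vecMulVec a b).rank : ℕ∞) ≤ c) :
    maxPayoff (lowRankPerception f) (A + s • Matrix.vecMulVec a b) c x y ≤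
      ((x ⬝ᵥ ((A + s • Matrix.vecMulVec a b) *ᵥ y) : ℝ) : EReal) := by
  set u := A + s • Matrix.vecMulVec a b with hu_def
  refine iSup₂_le fun w hw => EReal.coe_le_coe_iff.mpr (le_of_eq ?_)
  rw [hf.mem_concretization_iff hc hu] at hw
  obtain ⟨hE, -, -⟩ := hf.residual hc hw
  set E := w - u with hE_def
  -- This puts `a` in the column space of `u`, to which the residual `E` is orthogonal.
  have hub : u *ᵥ b = s • a := by
    rw [hu_def, Matrix.add_mulVec, hAb, Matrix.smul_mulVec, Matrix.vecMulVec_mulVec, hb]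
    simp
  have haE : Eᵀ *ᵥ a = 0 := by
    have h1 : Eᵀ * u = 0 := by
      have := congrArg Matrix.transpose hE
      rwa [Matrix.transpose_mul, Matrix.transpose_transpose, Matrix.transpose_zero] at this
    have h2 : Eᵀ *ᵥ (s • a) = 0 := by
      rw [← hub, Matrix.mulVec_mulVec, h1, Matrix.zero_mulVec]
    rw [Matrix.mulVec_smul] at h2
    exact (smul_eq_zero.mp h2).resolve_left hs
  have hAE : Aᵀ * E = 0 := by
    have h1 : uᵀ * E = Aᵀ * E := by
      rw [hu_def, Matrix.transpose_add, Matrix.transpose_smul, Matrix.transpose_vecMulVec,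
        Matrix.add_mul, Matrix.smul_mul, Matrix.vecMulVec_mul, ← Matrix.mulVec_transpose, haE,
        vecMulVec_zero']
      simp
    rw [← h1, hE]
  -- The columns of `E` lie in the null space of `Aᵀ`, so `x` may be replaced by `L x`, a multiple
  -- of `a`.
  have h0 : x ⬝ᵥ (E *ᵥ y) = 0 := by
    rw [← hL.mul_eq hAE]
    conv_lhs => rw [← hL.symm]
    rw [← mulVec_dotProduct_mulVec, hx, smul_dotProduct, Matrix.dotProduct_mulVec,
      ← Matrix.mulVec_transpose, haE, zero_dotProduct, smul_zero]
  rw [hE_def, Matrix.sub_mulVec, dotProduct_sub] at h0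
  linarith

theorem isNarrowlyReversible (hf : IsPerceptionCompatible f) {c₁ c₂ : ℕ∞} (hc : 1 ≤ c₁)
    (hcc : c₁ < c₂ ∨ (c₁ = c₂ ∧ ((min m n : ℕ) : ℕ∞) ≤ c₁))
    {A : Matrix (Fin m) (Fin n) ℝ} (hA : (A.rank : ℕ∞) ≤ c₁) :
    IsNarrowlyReversible (lowRankPerception f) A c₁ c₂ := by
  intro x _ k
  generalize (Pi.single k 1 : Fin n → ℝ) = y
  have hle : c₁ ≤ c₂ := by rcases hcc with h | h; exacts [h.le, h.1.le]
  have hc2 := hc.trans hle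
  refine le_antisymm (hf.minPayoff_le_iInf hc hle hA x y) ?_
  have hAmem : A ∈ narrowConcretization (lowRankPerception f) A c₁ c₂ :=
    (hf.mem_narrowConcretization_iff hc hle hA).mpr
      ⟨hA.trans hle, (hf.perception_eq_self_iff hc A).mpr hA⟩
  -- From `min m n` on perception is exact, and both concretization sets of `A` reduce to `A`.
  rcases le_or_gt ((min m n : ℕ) : ℕ∞) c₁ with hp | hp
  · refine (iInf₂_le A hAmem).trans (iSup₂_le fun w hw => le_iInf₂ fun u hu => ?_)
    rw [hf.mem_concretization_iff hc2 (hA.trans hle), hf.perception_of_le (hp.trans hle)] at hw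
    rw [hf.mem_concretization_iff hc hA, hf.perception_of_le hp] at hu
    rw [hw, hu]
  · have hlt : c₁ < c₂ := hcc.resolve_right fun h => h.2.not_gt hp
    have hpos : 1 ≤ min m n := by exact_mod_cast hc.trans hp.le
    obtain ⟨U, V, σ, h, -⟩ := hf.exists_isSVD A hpos le_rfl
    obtain ⟨N, hN⟩ := h.exists_isKerProj
    obtain ⟨L, hL⟩ := h.transpose.exists_isKerProj
    rw [hf.minPayoff_eq hc hA hL hN]
    refine EReal.le_coe_of_forall_pos fun δ hδ => ?_
    by_cases h0 : sigma A c₁ * norm2 (L *ᵥ x) * norm2 (N *ᵥ y) = 0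
    -- The witness `A` suffices: its rank is at most `c₁ < c₂`, so `σ_{c₂}(A) = 0`.
    · refine (iInf₂_le A hAmem).trans ?_
      rw [hf.maxPayoff_eq hc2 (hA.trans hle) hL hN, sigma_eq_zero (hA.trans_lt hlt), h0]
      exact EReal.coe_le_coe_iff.mpr (by linarith)
    · obtain ⟨s, a, b, hs, hs', ha, hb, hAb, haA, hx, hsδ⟩ :=
        exists_unit_directions hL hN (sigma_nonneg A c₁) hδ h0
      have hr : ((A + (-s) • Matrix.vecMulVec a b).rank : ℕ∞) ≤ c₂ := by
        have e1 : (A + (-s) • Matrix.vecMulVec a b).rank ≤ A.rank + 1 := by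
          refine (rank_add_le _ _).trans (Nat.add_le_add_left ?_ _)
          rw [← Matrix.smul_vecMulVec]
          exact Matrix.rank_vecMulVec_le _ _
        calc ((A + (-s) • Matrix.vecMulVec a b).rank : ℕ∞) ≤ A.rank + 1 := by exact_mod_cast e1
          _ ≤ c₁ + 1 := by gcongr
          _ ≤ c₂ := Order.add_one_le_of_lt hlt
      refine (iInf₂_le (A + (-s) • Matrix.vecMulVec a b)
        ((hf.mem_narrowConcretization_iff hc hle hA).mpr ⟨hr,
          hf.perception_add_smul_vecMulVec hc hA (by rwa [abs_neg, abs_of_pos hs]) ha hb hAb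
            haA⟩)).trans ?_
      refine (hf.maxPayoff_add_smul_vecMulVec_le hc2 (neg_ne_zero.mpr hs.ne') hL hb hAb hx
        hr).trans (EReal.coe_le_coe_iff.mpr ?_)
      rw [dotProduct_add_smul_vecMulVec]
      linarith

end IsPerceptionCompatible

end LimitedPerception

theorem mainTheorem5 {m n : ℕ}
    (f : Set (LimitedPerception.Triple m n) → Matrix (Fin m) (Fin n) ℝ)
    (hf : LimitedPerception.IsPerceptionCompatible f) :
    (∀ (T A : Matrix (Fin m) (Fin n) ℝ) (c : ℕ∞), 1 ≤ c →
      A = LimitedPerception.lowRankPerception f T c →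
      ∀ {k l : ℕ} (L : Matrix (Fin m) (Fin l) ℝ) (N : Matrix (Fin n) (Fin k) ℝ),
        LimitedPerception.IsNullBasis Aᵀ L → LimitedPerception.IsNullBasis A N →
        ∀ (x : Fin m → ℝ) (y : Fin n → ℝ),
          LimitedPerception.minPayoff (LimitedPerception.lowRankPerception f) A c x y =
            ((x ⬝ᵥ (A *ᵥ y) - LimitedPerception.sigma A c *
              LimitedPerception.norm2 (Lᵀ *ᵥ x) * LimitedPerception.norm2 (Nᵀ *ᵥ y) : ℝ) : EReal) ∧
          LimitedPerception.maxPayoff (LimitedPerception.lowRankPerception f) A c x y =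
            ((x ⬝ᵥ (A *ᵥ y) + LimitedPerception.sigma A c *
              LimitedPerception.norm2 (Lᵀ *ᵥ x) * LimitedPerception.norm2 (Nᵀ *ᵥ y) : ℝ) : EReal)) ∧
    (∀ (T : Matrix (Fin m) (Fin n) ℝ) (c₁ c₂ : ℕ∞), 1 ≤ c₁ →
      (c₁ < c₂ ∨ (c₁ = c₂ ∧ ((min m n : ℕ) : ℕ∞) ≤ c₁)) →
      LimitedPerception.IsNarrowlyReversible (LimitedPerception.lowRankPerception f)
        (LimitedPerception.lowRankPerception f T c₁) c₁ c₂) := by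
  refine ⟨fun T A c hc hA k l L N hL hN x y => ?_, fun T c₁ c₂ hc hcc =>
    hf.isNarrowlyReversible hc hcc (hf.rank_perception_le hc T)⟩
  have hr : (A.rank : ℕ∞) ≤ c := hA ▸ hf.rank_perception_le hc T
  have hL' := LimitedPerception.IsKerProj.of_isNullBasis hL
  have hN' := LimitedPerception.IsKerProj.of_isNullBasis hN
  -- The projections are `L Lᵀ` and `N Nᵀ`; the outer factor is an isometry and drops out of the
  -- norms.
  rw [hf.minPayoff_eq hc hr hL' hN', hf.maxPayoff_eq hc hr hL' hN', ← Matrix.mulVec_mulVec,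
    ← Matrix.mulVec_mulVec, LimitedPerception.norm2_mulVec_of_orthonormal hL.1,
    LimitedPerception.norm2_mulVec_of_orthonormal hN.1]
  exact ⟨rfl, rfl⟩
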